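/- Let $M$ be a smooth manifold of dimension $n\ge 1$ and let $(\tau,Z,\gamma,h)$ be an Aristotelian structure on $M$: $\tau\in\Omega^1(M)$ (the clock form) and $Z\in\Gamma(TM)$ (the field of observers) satisfy $\tau(Z)=1$, $\gamma\in\Gamma(\odot^2TM)$ is positive semidefinite with kernel $\mathrm{Span}(\tau)$, and $h\in\Gamma(\odot^2T^*M)$ is positive semidefinite with kernel $\mathrm{Span}(Z)$. Assume that it is integrable, $\tau\wedge d\tau=0$, and let $\alpha\in\Omega^1(M)$ be the one-form determined by $$d\tau=\tau\wedge\alpha,\qquad \iota_Z\alpha=0 .$$ (i) Write $\mathbb R^n=\mathbb R H\oplus\mathbb R^{n-1}$, and let $s_1,\dots,s_{n-1}$ be the standard basis of $\mathbb R^{n-1}$. Let $G_A=\{\mathrm{diag}(1,A): A\in O(n-1)\}\subset GL(n,\mathbb R)$ with Lie algebra $\mathfrak g_A=\{\mathrm{diag}(0,A): A\in\mathfrak{so}(n-1)\}$. Let $\pi\colon P\to M$ be a reduction of the frame bundle of $M$ to $G_A$ that defines the Aristotelian structure, i.e. each frame $u\in P$, regarded as an isomorphism $u\colon\mathbb R^n\to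 T_{\pi(u)}M$, carries $H$, the projection $\eta\colon\mathbb R^n\to\mathbb R$ to the coefficient of $H$, $\sum_a s_a\otimes s_a$ and the Euclidean inner product of the $\mathbb R^{n-1}$-components to $Z$, $\tau$, $\gamma$ and $h$ respectively. Let $\vartheta_u(\xi)=u^{-1}(\pi_*\xi)$ be the soldering form on $P$, let $\omega\in\Omega^1(P,\mathfrak g_A)$ be any Ehresmann (principal) connection on $P$, let $\Theta=d\vartheta+\omega\wedge\vartheta\in\Omega^2(P,\mathbb R^n)$ be its torsion, and let $\bar Z$ be the $\omega$-horizontal lift of $Z$ to $P$. Then, for all $u\in P$ with $x=\pi(u)$, $$(\pi^*\alpha)_u=\big\langle u(\iota_{\bar Z_u}\Theta_u),\tau_x\big\rangle ,$$ i.e. $\alpha_x(\pi_*\xi)=\tau_x\big(u(\Theta_u(\bar Z_u,\xi))\big)$ for all $\xi\in T_uP$. (ii) On $M$: for every linear connection $\nabla^A$ on $TM$ that preserves the structure ($\nabla^A\tau=0$, $\nabla^AZ=0$, $\nabla^A\gamma=0$, $\nabla^Ah=0$), with torsion $T^{\nabla^A}(X,Y)=\nabla^A_XY-\nabla^A_YX-[X,Y]$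 and $\bar T^{\nabla^A}=\tau\circ T^{\nabla^A}$, one has $$\alpha=\iota_Z\bar T^{\nabla^A}.$$ -/

import Mathlib

open Bundle Manifold
open scoped ContDiff RealInnerProductSpace

set_option maxSynthPendingDepth 3

noncomputable section

/-! ## Differential forms of degree one and their exterior derivatives -/

section Forms

variable {E : Type*} [NormedAddCommGroup E] [NormedSpace ℝ E]
  {M : Type*} [TopologicalSpace M] [ChartedSpace E M]
  {F : Type*} [NormedAddCommGroup F] [NormedSpace ℝ F]

/-- The one-form `θ` on the manifold `M`, with values in the vector space `F`, is smooth. -/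
def SmoothOneForm [IsManifold 𝓘(ℝ, E) ∞ M] (θ : Π x : M, TangentSpace 𝓘(ℝ, E) x →L[ℝ] F) :
    Prop :=
  ContMDiff 𝓘(ℝ, E) (𝓘(ℝ, E).prod 𝓘(ℝ, E →L[ℝ] F)) ∞
    (fun x ↦ TotalSpace.mk' (E →L[ℝ] F)
      (E := fun x : M ↦ TangentSpace 𝓘(ℝ, E) x →L[ℝ] Bundle.Trivial M F x) x (θ x))

/-- The coordinate expression of the one-form `θ` in the preferred chart `φ` around `x₀`:
the pullback of `θ` by `φ⁻¹`, a function from the model space `E` to `E →L[ℝ] F`. -/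
def oneFormInChart (θ : Π x : M, TangentSpace 𝓘(ℝ, E) x →L[ℝ] F) (x₀ : M) : E → E →L[ℝ] F :=
  fun y ↦ (θ ((extChartAt 𝓘(ℝ, E) x₀).symm y)).comp
    (mfderiv 𝓘(ℝ, E) 𝓘(ℝ, E) (extChartAt 𝓘(ℝ, E) x₀).symm y)

/-- The exterior derivative `dθ` of an `F`-valued one-form at `x`, as a function of two tangent
vectors. In coordinates `(dθ)(v, w) = (D_v θ)(w) - (D_w θ)(v)`, so that
`dθ(X, Y) = X(θ(Y)) - Y(θ(X)) - θ([X, Y])`. -/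
def extDerivOneForm (θ : Π x : M, TangentSpace 𝓘(ℝ, E) x →L[ℝ] F) (x : M)
    (v w : TangentSpace 𝓘(ℝ, E) x) : F :=
  let φ := extChartAt 𝓘(ℝ, E) x
  let D : E →L[ℝ] E →L[ℝ] F := fderiv ℝ (oneFormInChart θ x) (φ x)
  let v' : E := mfderiv 𝓘(ℝ, E) 𝓘(ℝ, E) φ x v
  let w' : E := mfderiv 𝓘(ℝ, E) 𝓘(ℝ, E) φ x w
  D v' w' - D w' v'

end Forms

/-! ## Aristotelian structures -/

section Aristotelian

/-- The model space of an `(m + 1)`-dimensional manifold. -/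
abbrev ModelE (m : ℕ) : Type := EuclideanSpace ℝ (Fin (m + 1))

variable (m : ℕ) (M : Type*) [TopologicalSpace M] [ChartedSpace (ModelE m) M]
  [IsManifold (𝓡 (m + 1)) ∞ M]

/-- An Aristotelian structure `(τ, Z, γ, h)` on a manifold `M` of dimension `n = m + 1`. -/
structure AristotelianStructure where
  /-- the clock form -/
  τ : Π x : M, TangentSpace (𝓡 (m + 1)) x →L[ℝ] ℝ
  /-- the vector field of observers -/
  Z : Π x : M, TangentSpace (𝓡 (m + 1)) x
  /-- the spatial cometric, a symmetric bilinear form on the cotangent spaces -/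
  γ : Π x : M, (TangentSpace (𝓡 (m + 1)) x →L[ℝ] ℝ) →L[ℝ]
    (TangentSpace (𝓡 (m + 1)) x →L[ℝ] ℝ) →L[ℝ] ℝ
  /-- the spatial metric, a symmetric bilinear form on the tangent spaces -/
  h : Π x : M, TangentSpace (𝓡 (m + 1)) x →L[ℝ] TangentSpace (𝓡 (m + 1)) x →L[ℝ] ℝ
  smooth_τ : SmoothOneForm τ
  smooth_Z : ContMDiff (𝓡 (m + 1)) ((𝓡 (m + 1)).prod (𝓡 (m + 1))) ∞
    (fun x ↦ TotalSpace.mk' (ModelE m) (E := fun x : M ↦ TangentSpace (𝓡 (m + 1)) x) x (Z x))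
  smooth_γ : ContMDiff (𝓡 (m + 1))
    ((𝓡 (m + 1)).prod 𝓘(ℝ, (ModelE m →L[ℝ] ℝ) →L[ℝ] (ModelE m →L[ℝ] ℝ) →L[ℝ] ℝ)) ∞
    (fun x ↦ TotalSpace.mk' ((ModelE m →L[ℝ] ℝ) →L[ℝ] (ModelE m →L[ℝ] ℝ) →L[ℝ] ℝ)
      (E := fun x : M ↦ (TangentSpace (𝓡 (m + 1)) x →L[ℝ] Bundle.Trivial M ℝ x) →L[ℝ]
        (TangentSpace (𝓡 (m + 1)) x →L[ℝ] Bundle.Trivial M ℝ x) →L[ℝ] Bundle.Trivial M ℝ x)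
      x (γ x))
  smooth_h : ContMDiff (𝓡 (m + 1)) ((𝓡 (m + 1)).prod 𝓘(ℝ, ModelE m →L[ℝ] ModelE m →L[ℝ] ℝ)) ∞
    (fun x ↦ TotalSpace.mk' (ModelE m →L[ℝ] ModelE m →L[ℝ] ℝ)
      (E := fun x : M ↦ TangentSpace (𝓡 (m + 1)) x →L[ℝ]
        TangentSpace (𝓡 (m + 1)) x →L[ℝ] Bundle.Trivial M ℝ x) x (h x))
  τ_Z : ∀ x, τ x (Z x) = 1
  γ_symm : ∀ x β β', γ x β β' = γ x β' β
  γ_nonneg : ∀ x β, 0 ≤ γ x β β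
  /-- `ι_τ γ = 0`, and `γ` is nondegenerate modulo the span of `τ` -/
  γ_self_eq_zero_iff : ∀ x β, γ x β β = 0 ↔ ∃ c : ℝ, β = c • τ x
  h_symm : ∀ x v w, h x v w = h x w v
  h_nonneg : ∀ x v, 0 ≤ h x v v
  /-- `ι_Z h = 0`, and `h` is nondegenerate modulo the span of `Z` -/
  h_self_eq_zero_iff : ∀ x v, h x v v = 0 ↔ ∃ c : ℝ, v = c • Z x

variable {m M}

/-- Frobenius integrability of the clock form: `τ ∧ dτ = 0`. -/
def AristotelianStructure.IsIntegrable (A : AristotelianStructure m M) : Prop :=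
  ∀ (x : M) (u v w : TangentSpace (𝓡 (m + 1)) x),
    A.τ x u * extDerivOneForm A.τ x v w + A.τ x v * extDerivOneForm A.τ x w u +
      A.τ x w * extDerivOneForm A.τ x u v = 0

end Aristotelian

/-! ## Compatible linear connections -/

section Connection

variable {m : ℕ} {M : Type*} [TopologicalSpace M] [ChartedSpace (ModelE m) M]
  [IsManifold (𝓡 (m + 1)) ∞ M]

/-- The linear connections on `M`: covariant derivatives on the tangent bundle, where
`cov Y x v` is `(∇_v Y)(x)`. -/
abbrev LinearConnection (m : ℕ) (M : Type*) [TopologicalSpace M] [ChartedSpace (ModelE m) M]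
    [IsManifold (𝓡 (m + 1)) ∞ M] :=
  CovariantDerivative (𝓡 (m + 1)) (ModelE m) (fun x : M ↦ TangentSpace (𝓡 (m + 1)) x)

/-- The vector field `Y` is differentiable at `x`. -/
def VectorFieldDiffAt (Y : Π x : M, TangentSpace (𝓡 (m + 1)) x) (x : M) : Prop :=
  MDifferentiableAt (𝓡 (m + 1)) ((𝓡 (m + 1)).prod (𝓡 (m + 1)))
    (fun y ↦ TotalSpace.mk' (ModelE m) (E := fun x : M ↦ TangentSpace (𝓡 (m + 1)) x) y (Y y)) x

/-- The one-form `β` is differentiable at `x`. -/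
def OneFormDiffAt (β : Π x : M, TangentSpace (𝓡 (m + 1)) x →L[ℝ] ℝ) (x : M) : Prop :=
  MDifferentiableAt (𝓡 (m + 1)) ((𝓡 (m + 1)).prod 𝓘(ℝ, ModelE m →L[ℝ] ℝ))
    (fun y ↦ TotalSpace.mk' (ModelE m →L[ℝ] ℝ)
      (E := fun x : M ↦ TangentSpace (𝓡 (m + 1)) x →L[ℝ] Bundle.Trivial M ℝ x) y (β y)) x

lemma tensorialAt_dual (cov : LinearConnection m M)
    (β : Π x : M, TangentSpace (𝓡 (m + 1)) x →L[ℝ] ℝ) (x : M) (hβ : OneFormDiffAt β x)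
    (v : TangentSpace (𝓡 (m + 1)) x) :
    TensorialAt (𝓡 (m + 1)) (ModelE m)
      (fun Y : Π x : M, TangentSpace (𝓡 (m + 1)) x ↦
        mvfderiv (𝓡 (m + 1)) (fun y ↦ β y (Y y)) x v - β x (cov Y x v)) x := by
  have key : ∀ {Y : Π x : M, TangentSpace (𝓡 (m + 1)) x}, VectorFieldDiffAt Y x →
      MDifferentiableAt (𝓡 (m + 1)) 𝓘(ℝ, ℝ) (fun y ↦ β y (Y y)) x := by
    intro Y hY
    have := MDifferentiableAt.clm_bundle_apply (F₁ := ModelE m) (F₂ := ℝ)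
      (E₁ := fun x : M ↦ TangentSpace (𝓡 (m + 1)) x) (E₂ := Bundle.Trivial M ℝ)
      (b := fun y ↦ y) (ϕ := β) (v := Y) hβ hY
    rw [mdifferentiableAt_totalSpace] at this
    exact this.2
  constructor
  · intro f Y hf hY
    have h1 := mvfderiv_fun_mul hf (key hY)
    simp [cov.isCovariantDerivativeOn.leibniz hY hf, h1]
    ring
  · intro Y Y' hY hY'
    have h1 := mvfderiv_fun_add (key hY) (key hY')
    simp [cov.isCovariantDerivativeOn.add hY hY', h1]
    ring

open Classical in
/-- The induced covariant derivative of one-forms: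
`(∇_v β)(Y) = v(β(Y)) - β(∇_v Y)`, for one-forms `β` differentiable at `x`. -/
def covOneForm (cov : LinearConnection m M) (β : Π x : M, TangentSpace (𝓡 (m + 1)) x →L[ℝ] ℝ)
    (x : M) (v : TangentSpace (𝓡 (m + 1)) x) : TangentSpace (𝓡 (m + 1)) x →L[ℝ] ℝ :=
  if hβ : OneFormDiffAt β x then TensorialAt.mkHom _ x (tensorialAt_dual cov β x hβ v) else 0

/-- The linear connection preserves the Aristotelian structure:
`∇τ = 0`, `∇Z = 0`, `∇γ = 0` and `∇h = 0`. -/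
structure IsCompatibleConnection (A : AristotelianStructure m M) (cov : LinearConnection m M) :
    Prop where
  cov_τ : ∀ x v, covOneForm cov A.τ x v = 0
  cov_Z : ∀ x v, cov A.Z x v = 0
  cov_γ : ∀ (β β' : Π x : M, TangentSpace (𝓡 (m + 1)) x →L[ℝ] ℝ) (x : M)
    (v : TangentSpace (𝓡 (m + 1)) x), OneFormDiffAt β x → OneFormDiffAt β' x →
    mvfderiv (𝓡 (m + 1)) (fun y ↦ A.γ y (β y) (β' y)) x v =
      A.γ x (covOneForm cov β x v) (β' x) + A.γ x (β x) (covOneForm cov β' x v)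
  cov_h : ∀ (Y W : Π x : M, TangentSpace (𝓡 (m + 1)) x) (x : M)
    (v : TangentSpace (𝓡 (m + 1)) x), VectorFieldDiffAt Y x → VectorFieldDiffAt W x →
    mvfderiv (𝓡 (m + 1)) (fun y ↦ A.h y (Y y) (W y)) x v =
      A.h x (cov Y x v) (W x) + A.h x (Y x) (cov W x v)

end Connection

/-! ## The structure group -/

section Group

/-- `ℝⁿ = ℝ H ⊕ ℝ^(n - 1)` with `n = m + 1` and `H = (1, 0)`; the standard vectors
`s_a` are `(0, e_a)`, and the projection to the first factor is the covector `η`. -/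
abbrev FrameModel (m : ℕ) : Type := ℝ × EuclideanSpace ℝ (Fin m)

/-- The embedding `O(m) → GL(m + 1, ℝ)`, `A ↦ diag(1, A)`. -/
def blockHom (m : ℕ) :
    (EuclideanSpace ℝ (Fin m) ≃ₗᵢ[ℝ] EuclideanSpace ℝ (Fin m)) →*
      (FrameModel m ≃L[ℝ] FrameModel m) where
  toFun A := (ContinuousLinearEquiv.refl ℝ ℝ).prodCongr A.toContinuousLinearEquiv
  map_one' := rfl
  map_mul' _ _ := rfl

/-- The Aristotelian structure group `G_A = {diag(1, A) | A ∈ O(m)}` inside `GL(m + 1, ℝ)`. -/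
def GA (m : ℕ) : Subgroup (FrameModel m ≃L[ℝ] FrameModel m) := (blockHom m).range

/-- The Lie algebra `𝔤_A = {diag(0, A) | A ∈ 𝔰𝔬(m)}` inside `𝔤𝔩(m + 1, ℝ)`. -/
def lieGA (m : ℕ) : Set (FrameModel m →L[ℝ] FrameModel m) :=
  {B | ∃ A : EuclideanSpace ℝ (Fin m) →L[ℝ] EuclideanSpace ℝ (Fin m),
    (∀ v w, ⟪A v, w⟫ = -⟪v, A w⟫) ∧ B = ContinuousLinearMap.prodMap 0 A}

end Group

/-! ## The frame bundle, `G_A`-structures and Ehresmann connections -/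

section GStructure

/-- The total space of the smooth vector bundle `Hom(ℝⁿ, TM)` over `M`. Its points are pairs
`⟨x, u⟩` with `u : ℝⁿ → T_x M` linear; the frame bundle of `M` is its open subset of
invertible `u`, with the induced manifold structure. -/
abbrev HomBundle (m : ℕ) (M : Type*) [TopologicalSpace M] [ChartedSpace (ModelE m) M]
    [IsManifold (𝓡 (m + 1)) ∞ M] : Type _ :=
  TotalSpace (FrameModel m →L[ℝ] ModelE m)
    (fun x : M ↦ Bundle.Trivial M (FrameModel m) x →L[ℝ] TangentSpace (𝓡 (m + 1)) x)

variable {m : ℕ} {M : Type*} [TopologicalSpace M] [ChartedSpace (ModelE m) M]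
  [IsManifold (𝓡 (m + 1)) ∞ M]

/-- The linear map `ℝⁿ → T_x M` underlying a point over `x`. -/
def HomBundle.map (u : HomBundle m M) : FrameModel m →L[ℝ] TangentSpace (𝓡 (m + 1)) u.proj :=
  u.snd

/-- The right action of `GL(n, ℝ)`: `u · B = u ∘ B`. -/
def HomBundle.act (u : HomBundle m M) (B : FrameModel m →L[ℝ] FrameModel m) : HomBundle m M :=
  ⟨u.proj, u.map.comp B⟩

variable (m M) in
/-- A reduction `π : P → M` of the frame bundle of `M` to the structure group `G_A`: a manifold
`P` embedded in the frame bundle as a principal `G_A`-subbundle, that is, `P` admits smooth local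
sections over `M` and its fibres are orbits of `G_A`. -/
structure GAStructure {EP : Type*} [NormedAddCommGroup EP] [NormedSpace ℝ EP]
    (P : Type*) [TopologicalSpace P] [ChartedSpace EP P] where
  /-- the inclusion of `P` into the frame bundle -/
  frame : P → HomBundle m M
  isSmoothEmbedding : Manifold.IsSmoothEmbedding 𝓘(ℝ, EP)
    ((𝓡 (m + 1)).prod 𝓘(ℝ, FrameModel m →L[ℝ] ModelE m)) ∞ frame
  isInvertible : ∀ p, (frame p).map.IsInvertible
  /-- the right action of the structure group on `P` -/
  act : P → GA m → P
  frame_act : ∀ p g, frame (act p g) = (frame p).act (g.1 : FrameModel m →L[ℝ] FrameModel m)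
  transitive : ∀ p q, (frame p).proj = (frame q).proj → ∃ g, q = act p g
  exists_section : ∀ x : M, ∃ s : M → P, ContMDiffAt (𝓡 (m + 1)) 𝓘(ℝ, EP) ∞ s x ∧
    ∀ᶠ y in nhds x, (frame (s y)).proj = y

namespace GAStructure

variable {EP : Type*} [NormedAddCommGroup EP] [NormedSpace ℝ EP]
  {P : Type*} [TopologicalSpace P] [ChartedSpace EP P]

/-- The projection `π : P → M`. -/
def proj (S : GAStructure m M (EP := EP) P) (p : P) : M := (S.frame p).proj

/-- The frame `u : ℝⁿ → T_{π(u)} M` that a point of `P` is. -/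
def u (S : GAStructure m M (EP := EP) P) (p : P) :
    FrameModel m →L[ℝ] TangentSpace (𝓡 (m + 1)) (S.proj p) := (S.frame p).map

/-- The differential `π_* : T_p P → T_{π(p)} M`. -/
def dπ (S : GAStructure m M (EP := EP) P) (p : P) :
    TangentSpace 𝓘(ℝ, EP) p →L[ℝ] TangentSpace (𝓡 (m + 1)) (S.proj p) :=
  mfderiv 𝓘(ℝ, EP) (𝓡 (m + 1)) S.proj p

/-- The frames in `P` are adapted to `(τ, Z, γ, h)`: each `u` in `P` carries the
`G_A`-invariant tensors `η`, `H`, `δ^{ab} s_a ⊙ s_b`, `δ_{ab} σ^a ⊙ σ^b` of `ℝⁿ` to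
`τ`, `Z`, `γ`, `h`. So the Aristotelian structure is the one defined by `P`. -/
structure Defines (S : GAStructure m M (EP := EP) P) (A : AristotelianStructure m M) :
    Prop where
  τ_eq : ∀ p (a : FrameModel m), A.τ (S.proj p) (S.u p a) = a.1
  Z_eq : ∀ p, A.Z (S.proj p) = S.u p (1, 0)
  γ_eq : ∀ p (β β' : TangentSpace (𝓡 (m + 1)) (S.proj p) →L[ℝ] ℝ),
    A.γ (S.proj p) β β' = ∑ a : Fin m,
      β (S.u p (0, EuclideanSpace.single a 1)) * β' (S.u p (0, EuclideanSpace.single a 1))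
  h_eq : ∀ p (a b : FrameModel m), A.h (S.proj p) (S.u p a) (S.u p b) = ⟪a.2, b.2⟫

/-- The soldering form `ϑ(ξ) = u⁻¹(π_* ξ)`. -/
def soldering (S : GAStructure m M (EP := EP) P) (p : P) :
    TangentSpace 𝓘(ℝ, EP) p →L[ℝ] FrameModel m :=
  (S.u p).inverse.comp (S.dπ p)

/-- An Ehresmann (principal) connection on `P`: a smooth `𝔤_A`-valued one-form `ω` with
`R_g^* ω = Ad(g⁻¹) ω` and `ω(B^♯) = B` for `B` in `𝔤_A`, where the fundamental vector field `B^♯`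
is the velocity of the curves `t ↦ p · exp(t B)`. -/
structure IsEhresmannConnection [IsManifold 𝓘(ℝ, EP) ∞ P] (S : GAStructure m M (EP := EP) P)
    (conn : Π p : P, TangentSpace 𝓘(ℝ, EP) p →L[ℝ] (FrameModel m →L[ℝ] FrameModel m)) :
    Prop where
  smooth : SmoothOneForm conn
  mem_lie : ∀ p ξ, conn p ξ ∈ lieGA m
  equivariant : ∀ (p : P) (g : GA m) (ξ : TangentSpace 𝓘(ℝ, EP) p),
    conn (S.act p g) (mfderiv 𝓘(ℝ, EP) 𝓘(ℝ, EP) (fun q ↦ S.act q g) p ξ) =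
      (g.1.symm : FrameModel m →L[ℝ] FrameModel m).comp
        ((conn p ξ).comp (g.1 : FrameModel m →L[ℝ] FrameModel m))
  fundamental : ∀ B ∈ lieGA m, ∀ c : ℝ → P,
    (∀ t, S.frame (c t) = (S.frame (c 0)).act (NormedSpace.exp (t • B))) →
    conn (c 0) (mfderiv 𝓘(ℝ, ℝ) 𝓘(ℝ, EP) c 0 (1 : ℝ)) = B

/-- The torsion form `Θ = dϑ + ω ∧ ϑ` of the connection `ω`, an `ℝⁿ`-valued two-form on `P`. -/
def torsionForm (S : GAStructure m M (EP := EP) P)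
    (conn : Π p : P, TangentSpace 𝓘(ℝ, EP) p →L[ℝ] (FrameModel m →L[ℝ] FrameModel m))
    (p : P) (ξ ζ : TangentSpace 𝓘(ℝ, EP) p) : FrameModel m :=
  extDerivOneForm S.soldering p ξ ζ + (conn p ξ (S.soldering p ζ) - conn p ζ (S.soldering p ξ))

/-- `X'` is the horizontal lift to `P` of the vector field `X` on `M`. -/
def IsHorizontalLift (S : GAStructure m M (EP := EP) P)
    (conn : Π p : P, TangentSpace 𝓘(ℝ, EP) p →L[ℝ] (FrameModel m →L[ℝ] FrameModel m))
    (X : Π x : M, TangentSpace (𝓡 (m + 1)) x) (X' : Π p : P, TangentSpace 𝓘(ℝ, EP) p) : Prop :=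
  ∀ p, conn p (X' p) = 0 ∧ S.dπ p (X' p) = X (S.proj p)

end GAStructure

end GStructure

end

/-! Contracting `dτ = τ ∧ α` with `Z` gives `dτ(Z, v) = τ(Z) α(v) - τ(v) α(Z) = α(v)`, so `α = ι_Z
dτ`. Both parts then say that the `τ`-component of the torsion, contracted with `Z`, is `ι_Z dτ`.

On `P`, every frame carries `η` to `τ`, so `η ∘ ϑ = π^* τ` (`fst_comp_soldering`). Elements of `𝔤_A`
have zero first row, so `η` annihilates `ω ∧ ϑ` and `η ∘ Θ = d(π^* τ) = π^* dτ`
(`GAStructure.τ_torsionForm`). The horizontal lift enters only through `π_* Z̄ = Z`. The analytic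
input is that `d` commutes with pullback (`extDerivOneForm_pullbackOneForm`) and with `η`
(`extDerivOneForm_clm_comp`), which requires the soldering form to be smooth
(`smoothOneForm_soldering`).

On `M`, `∇Z = 0` and `∇τ = 0` give `τ(T(Z, V)) = τ(∇_Z V) - τ([Z, V]) = Z(τ(V)) - τ([Z, V])`. This
is `dτ(Z, V)` by the invariant formula (`extDerivOneForm_apply_vectorField`), because `τ(Z) = 1` is
constant (`IsCompatibleConnection.τ_torsion`). -/

/-! ### Pullback of one-forms and naturality of the exterior derivative -/

section PullbackOneForm

open Filter Set
open scoped Topology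

variable {E : Type*} [NormedAddCommGroup E] [NormedSpace ℝ E]
  {M : Type*} [TopologicalSpace M] [ChartedSpace E M]
  {E' : Type*} [NormedAddCommGroup E'] [NormedSpace ℝ E']
  {N : Type*} [TopologicalSpace N] [ChartedSpace E' N]
  {E'' : Type*} [NormedAddCommGroup E''] [NormedSpace ℝ E'']
  {N' : Type*} [TopologicalSpace N'] [ChartedSpace E'' N']
  {F : Type*} [NormedAddCommGroup F] [NormedSpace ℝ F]

variable (E E') in
/-- The pullback `g^* θ` of a one-form along a map of manifolds. -/
noncomputable def pullbackOneForm (g : N → M) (θ : Π x : M, TangentSpace 𝓘(ℝ, E) x →L[ℝ] F) :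
    Π y : N, TangentSpace 𝓘(ℝ, E') y →L[ℝ] F :=
  fun y ↦ (θ (g y)).comp (mfderiv 𝓘(ℝ, E') 𝓘(ℝ, E) g y)

/-- A pullback at a point depends only on the germ of the map; this allows `g` to be replaced by its
expression in charts, which agrees with it only locally. -/
lemma pullbackOneForm_congr {g₁ g₂ : N → M} {y : N} (h : g₁ =ᶠ[𝓝 y] g₂)
    (θ : Π x : M, TangentSpace 𝓘(ℝ, E) x →L[ℝ] F) :
    pullbackOneForm E E' g₁ θ y = pullbackOneForm E E' g₂ θ y := by
  -- All tangent spaces are definitionally the model space, so the base point can be substituted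
  -- while the linear map stays fixed.
  have key : ∀ (x x' : M) (_ : x = x') (L : E' →L[ℝ] E),
      ((θ x : E →L[ℝ] F).comp L) = ((θ x' : E →L[ℝ] F).comp L) := by
    rintro x _ rfl L; rfl
  have h2 : (mfderiv 𝓘(ℝ, E') 𝓘(ℝ, E) g₁ y : E' →L[ℝ] E) = mfderiv 𝓘(ℝ, E') 𝓘(ℝ, E) g₂ y :=
    h.mfderiv_eq
  have h3 := key _ _ h.eq_of_nhds (mfderiv 𝓘(ℝ, E') 𝓘(ℝ, E) g₁ y)
  refine h3.trans ?_
  exact congrArg (fun L : E' →L[ℝ] E ↦ (θ (g₂ y) : E →L[ℝ] F).comp L) h2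

lemma pullbackOneForm_comp {g : N → M} {f : N' → N} {y : N'}
    (hg : MDifferentiableAt 𝓘(ℝ, E') 𝓘(ℝ, E) g (f y))
    (hf : MDifferentiableAt 𝓘(ℝ, E'') 𝓘(ℝ, E') f y)
    (θ : Π x : M, TangentSpace 𝓘(ℝ, E) x →L[ℝ] F) :
    pullbackOneForm E E'' (g ∘ f) θ y = pullbackOneForm E' E'' f (pullbackOneForm E E' g θ) y := by
  simp only [pullbackOneForm, mfderiv_comp y hg hf, ContinuousLinearMap.comp_assoc]
  rfl

variable [IsManifold 𝓘(ℝ, E) ∞ M]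

lemma mdifferentiableAt_extChartAt_symm {x₀ : M} {y : E}
    (hy : y ∈ (extChartAt 𝓘(ℝ, E) x₀).target) :
    MDifferentiableAt 𝓘(ℝ, E) 𝓘(ℝ, E) (extChartAt 𝓘(ℝ, E) x₀).symm y := by
  have := mdifferentiableWithinAt_extChartAt_symm (I := 𝓘(ℝ, E)) hy
  rwa [modelWithCornersSelf_coe, range_id, mdifferentiableWithinAt_univ] at this

/-- The preferred chart has identity derivative at its own base point. -/
lemma extDerivOneForm_eq (θ : Π x : M, TangentSpace 𝓘(ℝ, E) x →L[ℝ] F) (x : M)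
    (v w : TangentSpace 𝓘(ℝ, E) x) :
    extDerivOneForm θ x v w =
      (fderiv ℝ (oneFormInChart θ x) (extChartAt 𝓘(ℝ, E) x x) (v : E) : E →L[ℝ] F) (w : E) -
        (fderiv ℝ (oneFormInChart θ x) (extChartAt 𝓘(ℝ, E) x x) (w : E) : E →L[ℝ] F) (v : E) := by
  simp only [extDerivOneForm, mfderiv_extChartAt_self]
  rfl

/-- A smooth one-form has a smooth coordinate expression. -/
lemma SmoothOneForm.contDiffAt_oneFormInChart
    {θ : Π x : M, TangentSpace 𝓘(ℝ, E) x →L[ℝ] F} (hθ : SmoothOneForm θ) (x₀ : M) :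
    ContDiffAt ℝ ∞ (oneFormInChart θ x₀) (extChartAt 𝓘(ℝ, E) x₀ x₀) := by
  have h1 := ((contMDiffAt_hom_bundle (IB := 𝓘(ℝ, E)) _).1 (hθ x₀)).2
  have h2 : ContMDiffAt 𝓘(ℝ, E) 𝓘(ℝ, E) ∞ (extChartAt 𝓘(ℝ, E) x₀).symm
      (extChartAt 𝓘(ℝ, E) x₀ x₀) :=
    (contMDiffOn_extChartAt_symm x₀).contMDiffAt (extChartAt_target_mem_nhds x₀)
  rw [← contMDiffAt_iff_contDiffAt]
  refine (h1.comp_of_eq h2 (by simp)).congr_of_eventuallyEq ?_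
  filter_upwards [extChartAt_target_mem_nhds (I := 𝓘(ℝ, E)) x₀] with y hy
  have hs : (extChartAt 𝓘(ℝ, E) x₀).symm y ∈ (chartAt E x₀).source := by
    have := (extChartAt 𝓘(ℝ, E) x₀).map_target hy
    simpa using this
  -- The inverse trivialization of the tangent bundle is the derivative of the inverse chart, so the
  -- bundle coordinates of `θ` are its pullback by `φ⁻¹`.
  have e1 := TangentBundle.symmL_trivializationAt (I := 𝓘(ℝ, E)) hs
  have e2 := (extChartAt 𝓘(ℝ, E) x₀).right_inv hy
  rw [e2, modelWithCornersSelf_coe, range_id, mfderivWithin_univ] at e1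
  simp only [Function.comp_apply, ContinuousLinearMap.inCoordinates]
  have e3 : (trivializationAt F (Trivial M F) x₀).continuousLinearMapAt ℝ
      ((extChartAt 𝓘(ℝ, E) x₀).symm y) = ContinuousLinearMap.id ℝ F :=
    Trivial.continuousLinearMapAt_trivialization ..
  rw [e3]
  exact (congrArg (fun L : E →L[ℝ] E ↦
    (θ ((extChartAt 𝓘(ℝ, E) x₀).symm y) : E →L[ℝ] F).comp L) e1).symm

/-- Coordinate expression of a pullback. -/
lemma oneFormInChart_pullbackOneForm [IsManifold 𝓘(ℝ, E') ∞ N] {g : N → M}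
    (hg : ContMDiff 𝓘(ℝ, E') 𝓘(ℝ, E) ∞ g)
    (θ : Π x : M, TangentSpace 𝓘(ℝ, E) x →L[ℝ] F) (p : N) :
    oneFormInChart (pullbackOneForm E E' g θ) p =ᶠ[𝓝 (extChartAt 𝓘(ℝ, E') p p)]
      fun y ↦ (oneFormInChart θ (g p) (writtenInExtChartAt 𝓘(ℝ, E') 𝓘(ℝ, E) p g y)).comp
        (fderiv ℝ (writtenInExtChartAt 𝓘(ℝ, E') 𝓘(ℝ, E) p g) y) := by
  have hc : ContinuousAt (g ∘ (extChartAt 𝓘(ℝ, E') p).symm) (extChartAt 𝓘(ℝ, E') p p) :=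
    hg.continuous.continuousAt.comp (continuousAt_extChartAt_symm p)
  have hsrc : ∀ᶠ y in 𝓝 (extChartAt 𝓘(ℝ, E') p p),
      (g ∘ (extChartAt 𝓘(ℝ, E') p).symm) y ∈ (extChartAt 𝓘(ℝ, E) (g p)).source := by
    apply hc
    simp only [Function.comp_apply, extChartAt_to_inv]
    exact extChartAt_source_mem_nhds (g p)
  -- The source condition is needed on a neighbourhood of each nearby `y`, since `e2` below compares
  -- germs at `y`.
  filter_upwards [eventually_eventually_nhds.2 hsrc,
    extChartAt_target_mem_nhds (I := 𝓘(ℝ, E')) p] with y hy hyt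
  have hy0 := hy.self_of_nhds
  have hfd : MDifferentiableAt 𝓘(ℝ, E') 𝓘(ℝ, E)
      (writtenInExtChartAt 𝓘(ℝ, E') 𝓘(ℝ, E) p g) y := by
    refine MDifferentiableAt.comp (I' := 𝓘(ℝ, E)) y
      (mdifferentiableAt_extChartAt (by simpa using hy0)) ?_
    exact (hg.mdifferentiable (by simp) _).comp y (mdifferentiableAt_extChartAt_symm hyt)
  have e1 : oneFormInChart (pullbackOneForm E E' g θ) p y =
      pullbackOneForm E E' (g ∘ (extChartAt 𝓘(ℝ, E') p).symm) θ y :=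
    (pullbackOneForm_comp (hg.mdifferentiable (by simp) _)
      (mdifferentiableAt_extChartAt_symm hyt) θ).symm
  have e2 : g ∘ (extChartAt 𝓘(ℝ, E') p).symm =ᶠ[𝓝 y]
      (extChartAt 𝓘(ℝ, E) (g p)).symm ∘ writtenInExtChartAt 𝓘(ℝ, E') 𝓘(ℝ, E) p g := by
    filter_upwards [hy] with z hz
    simp only [Function.comp_apply, writtenInExtChartAt]
    exact ((extChartAt 𝓘(ℝ, E) (g p)).left_inv hz).symm
  refine e1.trans ((pullbackOneForm_congr e2 θ).trans ?_)
  refine (pullbackOneForm_comp (g := (extChartAt 𝓘(ℝ, E) (g p)).symm)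
    (f := writtenInExtChartAt 𝓘(ℝ, E') 𝓘(ℝ, E) p g) (y := y) (mdifferentiableAt_extChartAt_symm
    ((extChartAt 𝓘(ℝ, E) (g p)).map_source hy0)) hfd θ).trans ?_
  simp only [pullbackOneForm, mfderiv_eq_fderiv]
  rfl

/-- Exterior derivative commutes with pullback. -/
lemma extDerivOneForm_pullbackOneForm [IsManifold 𝓘(ℝ, E') ∞ N] {g : N → M}
    (hg : ContMDiff 𝓘(ℝ, E') 𝓘(ℝ, E) ∞ g)
    {θ : Π x : M, TangentSpace 𝓘(ℝ, E) x →L[ℝ] F} (p : N)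
    (hθ : DifferentiableAt ℝ (oneFormInChart θ (g p)) (extChartAt 𝓘(ℝ, E) (g p) (g p)))
    (v w : TangentSpace 𝓘(ℝ, E') p) :
    extDerivOneForm (pullbackOneForm E E' g θ) p v w =
      extDerivOneForm θ (g p) (mfderiv 𝓘(ℝ, E') 𝓘(ℝ, E) g p v)
        (mfderiv 𝓘(ℝ, E') 𝓘(ℝ, E) g p w) := by
  set f := writtenInExtChartAt 𝓘(ℝ, E') 𝓘(ℝ, E) p g with hf
  set y := extChartAt 𝓘(ℝ, E') p p with hy
  have hfy : f y = extChartAt 𝓘(ℝ, E) (g p) (g p) := by simp [hf, hy, writtenInExtChartAt]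
  have hfs : ContDiffAt ℝ ∞ f y := by
    have := (contMDiffAt_iff.1 (hg p)).2
    simpa [hf, hy, writtenInExtChartAt, contDiffWithinAt_univ] using this
  have hm : mfderiv 𝓘(ℝ, E') 𝓘(ℝ, E) g p = (fderiv ℝ f y : E' →L[ℝ] E) := by
    refine (if_pos (hg.mdifferentiable (by simp) p)).trans ?_
    rw [modelWithCornersSelf_coe, range_id, fderivWithin_univ]
  have hd : DifferentiableAt ℝ (fderiv ℝ f) y :=
    (hfs.fderiv_right (m := ∞) (by simp)).differentiableAt (by simp)
  -- The product rule leaves one second-order term, `θ(D²f(v, w))`; by symmetry it cancels in the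
  -- antisymmetrization.
  have hsymm : IsSymmSndFDerivAt ℝ f y := hfs.isSymmSndFDerivAt (by
    rw [minSmoothness_of_isRCLikeNormedField]; exact ENat.LEInfty.out)
  rw [← hfy] at hθ
  have hD : HasFDerivAt (fun y ↦ (oneFormInChart θ (g p) (f y)).comp (fderiv ℝ f y)) _ y :=
    (hθ.hasFDerivAt.comp y (hfs.differentiableAt (by simp)).hasFDerivAt).clm_comp hd.hasFDerivAt
  have hD' := (hD.congr_of_eventuallyEq (oneFormInChart_pullbackOneForm hg θ p)).fderiv
  rw [extDerivOneForm_eq, extDerivOneForm_eq, hD', hm, ← hfy]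
  have key : ∀ v w : E', fderiv ℝ (fderiv ℝ f) y v w = fderiv ℝ (fderiv ℝ f) y w v := hsymm
  clear hD hD' hm hsymm
  revert v w
  change ∀ v w : E', _
  intro v w
  have := key v w
  simp [this]
  rfl

end PullbackOneForm

/-! ### Smoothness of the soldering form and the clock component of the torsion form -/

section Soldering

open Filter Set
open scoped Topology

variable {m : ℕ} {M : Type*} [TopologicalSpace M] [ChartedSpace (ModelE m) M]
  [IsManifold (𝓡 (m + 1)) ∞ M]
  {EP : Type*} [NormedAddCommGroup EP] [NormedSpace ℝ EP]
  {P : Type*} [TopologicalSpace P] [ChartedSpace EP P]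

/-- Trivializations of vector bundles are fibrewise invertible. -/
lemma Bundle.Trivialization.isInvertible_continuousLinearMapAt {R B F : Type*} {E : B → Type*}
    [NontriviallyNormedField R] [∀ x, AddCommGroup (E x)] [∀ x, Module R (E x)]
    [NormedAddCommGroup F] [NormedSpace R F] [TopologicalSpace B]
    [TopologicalSpace (TotalSpace F E)]
    [∀ x, TopologicalSpace (E x)] [FiberBundle F E] [VectorBundle R F E]
    (t : Trivialization F (π F E)) [t.IsLinear R] [MemTrivializationAtlas t] {x : B}
    (hx : x ∈ t.baseSet) : (t.continuousLinearMapAt R x).IsInvertible :=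
  ⟨t.continuousLinearEquivAt R x hx, by
    ext v; simp [t.coe_linearMapAt_of_mem hx]⟩

section

variable {E : Type*} [NormedAddCommGroup E] [NormedSpace ℝ E]
  {N : Type*} [TopologicalSpace N] [ChartedSpace E N] [IsManifold 𝓘(ℝ, E) ∞ N]
  {F : Type*} [NormedAddCommGroup F] [NormedSpace ℝ F]

/-- A one-form is smooth as soon as its expressions in trivializations are. -/
lemma smoothOneForm_of_contMDiffAt_comp_symmL {θ : Π x : N, TangentSpace 𝓘(ℝ, E) x →L[ℝ] F}
    (h : ∀ x₀, ContMDiffAt 𝓘(ℝ, E) 𝓘(ℝ, E →L[ℝ] F) ∞ (fun x ↦ (θ x).comp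
      ((trivializationAt E (TangentSpace 𝓘(ℝ, E) (M := N)) x₀).symmL ℝ x)) x₀) :
    SmoothOneForm θ := by
  intro x₀
  rw [contMDiffAt_hom_bundle]
  refine ⟨contMDiffAt_id, (h x₀).congr_of_eventuallyEq (.of_forall fun x ↦ ?_)⟩
  have e3 : (trivializationAt F (Trivial N F) x₀).continuousLinearMapAt ℝ x =
    ContinuousLinearMap.id ℝ F := Trivial.continuousLinearMapAt_trivialization ..
  simp only [ContinuousLinearMap.inCoordinates]
  rw [e3]
  rfl

/-- If `u` is a family of frames over `b : P → N` with smooth coordinate expressions, the one-form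
`u⁻¹ ∘ db` is smooth. -/
lemma smoothOneForm_inverse_comp_mfderiv [CompleteSpace E] [IsManifold 𝓘(ℝ, EP) ∞ P] {b : P → N}
    (hb : ContMDiff 𝓘(ℝ, EP) 𝓘(ℝ, E) ∞ b) {u : Π q, F →L[ℝ] TangentSpace 𝓘(ℝ, E) (b q)}
    (hu : ∀ p, ContMDiffAt 𝓘(ℝ, EP) 𝓘(ℝ, F →L[ℝ] E) ∞ (fun q ↦
      ((trivializationAt E (TangentSpace 𝓘(ℝ, E) (M := N)) (b p)).continuousLinearMapAt ℝ
        (b q)).comp (u q)) p)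
    (hinv : ∀ q, (u q).IsInvertible) :
    SmoothOneForm fun q ↦ (u q).inverse.comp (mfderiv 𝓘(ℝ, EP) 𝓘(ℝ, E) b q) := by
  refine smoothOneForm_of_contMDiffAt_comp_symmL fun p ↦ ?_
  let t := trivializationAt E (TangentSpace 𝓘(ℝ, E) (M := N)) (b p)
  have ht : b p ∈ t.baseSet := FiberBundle.mem_baseSet_trivializationAt' _
  have hU : ContMDiffAt 𝓘(ℝ, EP) 𝓘(ℝ, F →L[ℝ] E) ∞
      (fun q ↦ (t.continuousLinearMapAt ℝ (b q)).comp (u q)) p :=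
    hu p
  have hd := (hb p).mfderiv_const (m := ∞) (by simp)
  have hUinv : ContMDiffAt 𝓘(ℝ, EP) 𝓘(ℝ, E →L[ℝ] F) ∞
      (fun q ↦ ((t.continuousLinearMapAt ℝ (b q)).comp (u q)).inverse) p := by
    obtain ⟨e, he⟩ := (t.isInvertible_continuousLinearMapAt (R := ℝ) ht).comp (hinv p)
    -- Inversion is smooth at an isomorphism of complete spaces; `F` inherits completeness from `E`
    -- through the frame in coordinates.
    have : CompleteSpace F :=
      (completeSpace_congr (e := e.toEquiv) e.isUniformEmbedding).2 inferInstance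
    refine ContMDiffAt.comp (g := ContinuousLinearMap.inverse) p (ContDiffAt.contMDiffAt ?_) hU
    exact ContinuousLinearMap.IsInvertible.contDiffAt_map_inverse ⟨e, he⟩
  refine (hUinv.clm_comp hd).congr_of_eventuallyEq ?_
  -- Near `p` the trivialization cancels: `(t ∘ u)⁻¹ ∘ (t ∘ db) = u⁻¹ ∘ db`.
  filter_upwards [hb.continuous.continuousAt (t.open_baseSet.mem_nhds ht)] with q hq
  obtain ⟨e, he⟩ := t.isInvertible_continuousLinearMapAt (R := ℝ) hq
  have h1 : ((t.continuousLinearMapAt ℝ (b q)).comp (u q)).inverse =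
      (u q).inverse.comp (e.symm : E →L[ℝ] TangentSpace 𝓘(ℝ, E) (b q)) := by
    rw [← he, ContinuousLinearMap.inverse_equiv_comp]
  have h2 : ∀ w, e.symm (t.continuousLinearMapAt ℝ (b q) w) = w := by
    intro w
    rw [← he]
    exact e.symm_apply_apply w
  rw [h1]
  refine ContinuousLinearMap.ext fun v ↦ ?_
  exact congrArg (u q).inverse (h2 _).symm

end

namespace GAStructure

lemma contMDiff_proj (S : GAStructure m M (EP := EP) P) :
    ContMDiff 𝓘(ℝ, EP) (𝓡 (m + 1)) ∞ S.proj := fun p ↦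
  ((contMDiffAt_hom_bundle (IB := 𝓡 (m + 1)) _).1 (S.isSmoothEmbedding.contMDiff p)).1

/-- Removes the domain side of the coordinate change in `Hom(ℝⁿ, TM)`, whose first factor is a
trivial bundle. -/
lemma symmL_trivializationAt_frameModel {B : Type*} [TopologicalSpace B] (x₀ x : B) :
    (trivializationAt (FrameModel m) (Trivial B (FrameModel m)) x₀).symmL ℝ x =
      ContinuousLinearMap.id ℝ (FrameModel m) := by
  let t := trivializationAt (FrameModel m) (Trivial B (FrameModel m)) x₀
  have hx : x ∈ t.baseSet := ⟨mem_univ x, mem_univ x⟩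
  refine ContinuousLinearMap.ext fun v ↦ ?_
  have h := t.symmL_continuousLinearMapAt (R := ℝ) hx v
  rw [t.continuousLinearMapAt_apply ℝ, t.coe_linearMapAt_of_mem hx] at h
  exact h

/-- The frames of a `G_A`-structure have smooth coordinate expressions. -/
lemma contMDiffAt_continuousLinearMapAt_comp_u (S : GAStructure m M (EP := EP) P) (p : P) :
    ContMDiffAt 𝓘(ℝ, EP) 𝓘(ℝ, FrameModel m →L[ℝ] ModelE m) ∞ (fun q ↦
      ((trivializationAt (ModelE m) (TangentSpace (𝓡 (m + 1)) (M := M))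
        (S.proj p)).continuousLinearMapAt ℝ (S.proj q)).comp (S.u q)) p := by
  refine ((contMDiffAt_hom_bundle (IB := 𝓡 (m + 1)) _).1
    (S.isSmoothEmbedding.contMDiff p)).2.congr_of_eventuallyEq (.of_forall fun q ↦ ?_)
  simp only [ContinuousLinearMap.inCoordinates]
  rw [symmL_trivializationAt_frameModel]
  rfl

/-- The soldering form is smooth. -/
lemma smoothOneForm_soldering [IsManifold 𝓘(ℝ, EP) ∞ P] (S : GAStructure m M (EP := EP) P) :
    SmoothOneForm S.soldering :=
  smoothOneForm_inverse_comp_mfderiv S.contMDiff_proj (u := S.u)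
    S.contMDiffAt_continuousLinearMapAt_comp_u S.isInvertible

/-- The first component of the soldering form is the pullback of the clock form. -/
lemma fst_comp_soldering {S : GAStructure m M (EP := EP) P} {A : AristotelianStructure m M}
    (hS : S.Defines A) (p : P) :
    (ContinuousLinearMap.fst ℝ ℝ (EuclideanSpace ℝ (Fin m))).comp (S.soldering p) =
      pullbackOneForm (ModelE m) EP S.proj A.τ p := by
  ext ξ
  have h := hS.τ_eq p ((S.u p).inverse (S.dπ p ξ))
  -- `inverse` is a genuine inverse only because frames are invertible; its default value is zero.
  have h2 : S.u p ((S.u p).inverse (S.dπ p ξ)) = S.dπ p ξ := by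
    have hi : (S.u p).IsInvertible := S.isInvertible p
    obtain ⟨e, he⟩ := hi
    rw [← he, ContinuousLinearMap.inverse_equiv]
    exact e.apply_symm_apply _
  rw [h2] at h
  exact h.symm

end GAStructure

variable {E : Type*} [NormedAddCommGroup E] [NormedSpace ℝ E]
  {N : Type*} [TopologicalSpace N] [ChartedSpace E N] [IsManifold 𝓘(ℝ, E) ∞ N]
  {F : Type*} [NormedAddCommGroup F] [NormedSpace ℝ F]
  {G : Type*} [NormedAddCommGroup G] [NormedSpace ℝ G]

/-- Exterior derivative commutes with constant linear maps of the values. -/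
lemma extDerivOneForm_clm_comp (L : F →L[ℝ] G) {θ : Π x : N, TangentSpace 𝓘(ℝ, E) x →L[ℝ] F}
    (x : N) (hθ : DifferentiableAt ℝ (oneFormInChart θ x) (extChartAt 𝓘(ℝ, E) x x))
    (v w : TangentSpace 𝓘(ℝ, E) x) :
    extDerivOneForm (fun y ↦ L.comp (θ y)) x v w = L (extDerivOneForm θ x v w) := by
  have h : oneFormInChart (fun y ↦ L.comp (θ y)) x = fun y ↦ L.comp (oneFormInChart θ x y) := rfl
  have hD := ((ContinuousLinearMap.compL ℝ E F G L).hasFDerivAt.comp _ hθ.hasFDerivAt).fderiv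
  have hD' : fderiv ℝ (oneFormInChart (fun y ↦ L.comp (θ y)) x) (extChartAt 𝓘(ℝ, E) x x) = _ := hD
  rw [extDerivOneForm_eq, extDerivOneForm_eq, hD', map_sub]
  rfl

/-- The torsion component `α = ⟨ι_{Z̄} Θ, τ⟩` on a `G_A`-structure. -/
lemma GAStructure.τ_torsionForm [IsManifold 𝓘(ℝ, EP) ∞ P] {S : GAStructure m M (EP := EP) P}
    {A : AristotelianStructure m M} (hS : S.Defines A)
    {conn : Π p : P, TangentSpace 𝓘(ℝ, EP) p →L[ℝ] (FrameModel m →L[ℝ] FrameModel m)}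
    (hconn : ∀ p ξ, conn p ξ ∈ lieGA m) (p : P) (ξ ζ : TangentSpace 𝓘(ℝ, EP) p) :
    A.τ (S.proj p) (S.u p (S.torsionForm conn p ξ ζ)) =
      extDerivOneForm A.τ (S.proj p) (S.dπ p ξ) (S.dπ p ζ) := by
  -- The first row of `diag(0, A)` vanishes, which removes `ω ∧ ϑ` from the `η`-component.
  have h0 : ∀ ξ a, (conn p ξ a).1 = 0 := by
    intro ξ a
    obtain ⟨B, -, hB⟩ := hconn p ξ
    rw [hB]; rfl
  have h1 := extDerivOneForm_clm_comp (ContinuousLinearMap.fst ℝ ℝ (EuclideanSpace ℝ (Fin m))) p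
    ((S.smoothOneForm_soldering.contDiffAt_oneFormInChart p).differentiableAt (by simp)) ξ ζ
  have h2 : (fun q ↦ (ContinuousLinearMap.fst ℝ ℝ (EuclideanSpace ℝ (Fin m))).comp
      (S.soldering q)) = pullbackOneForm (ModelE m) EP S.proj A.τ :=
    funext fun q ↦ S.fst_comp_soldering hS q
  rw [h2, extDerivOneForm_pullbackOneForm S.contMDiff_proj p
    ((A.smooth_τ.contDiffAt_oneFormInChart _).differentiableAt (by simp))] at h1
  rw [hS.τ_eq]
  simp only [torsionForm, Prod.fst_add, Prod.fst_sub, h0, sub_self, add_zero]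
  exact h1.symm

end Soldering

/-! ### The invariant formula for the exterior derivative of a one-form -/

section ExteriorDerivativeFormula

open Filter Set VectorField
open scoped Topology

variable {E : Type*} [NormedAddCommGroup E] [NormedSpace ℝ E]
  {M : Type*} [TopologicalSpace M] [ChartedSpace E M] [IsManifold 𝓘(ℝ, E) ∞ M]
  {F : Type*} [NormedAddCommGroup F] [NormedSpace ℝ F]

/-- The coordinate expression of a vector field in the preferred chart around `x₀`. -/
noncomputable def vectorFieldInChart (V : Π x : M, TangentSpace 𝓘(ℝ, E) x) (x₀ : M) : E → E :=
  mpullbackWithin 𝓘(ℝ, E) 𝓘(ℝ, E) (extChartAt 𝓘(ℝ, E) x₀).symm V (range 𝓘(ℝ, E))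

lemma differentiableAt_vectorFieldInChart [CompleteSpace E]
    {V : Π x : M, TangentSpace 𝓘(ℝ, E) x} {x : M}
    (hV : MDifferentiableAt 𝓘(ℝ, E) 𝓘(ℝ, E).tangent
      (fun y ↦ (⟨y, V y⟩ : TangentBundle 𝓘(ℝ, E) M)) x) :
    DifferentiableAt ℝ (vectorFieldInChart V x) (extChartAt 𝓘(ℝ, E) x x) := by
  exact (hV.mdifferentiableWithinAt (s := univ)
    |>.differentiableWithinAt_mpullbackWithin_vectorField).differentiableAt (by simp)

/-- The form is composed with the derivative of `φ⁻¹` and the field with its inverse; on the chart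
target the two cancel. -/
lemma oneFormInChart_vectorFieldInChart (θ : Π x : M, TangentSpace 𝓘(ℝ, E) x →L[ℝ] F)
    (V : Π x : M, TangentSpace 𝓘(ℝ, E) x) (x : M) {y : E}
    (hy : y ∈ (extChartAt 𝓘(ℝ, E) x).target) :
    oneFormInChart θ x y (vectorFieldInChart V x y) =
      θ ((extChartAt 𝓘(ℝ, E) x).symm y) (V ((extChartAt 𝓘(ℝ, E) x).symm y)) := by
  have hi := isInvertible_mfderivWithin_extChartAt_symm (I := 𝓘(ℝ, E)) hy
  have : (mfderivWithin 𝓘(ℝ, E) 𝓘(ℝ, E) (extChartAt 𝓘(ℝ, E) x).symm (range 𝓘(ℝ, E)) y)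
      ((mfderivWithin 𝓘(ℝ, E) 𝓘(ℝ, E) (extChartAt 𝓘(ℝ, E) x).symm (range 𝓘(ℝ, E)) y).inverse
        (V ((extChartAt 𝓘(ℝ, E) x).symm y))) = V ((extChartAt 𝓘(ℝ, E) x).symm y) := by
    obtain ⟨e, he⟩ := hi
    rw [← he, ContinuousLinearMap.inverse_equiv]
    exact e.apply_symm_apply _
  have h2 : mfderivWithin 𝓘(ℝ, E) 𝓘(ℝ, E) (extChartAt 𝓘(ℝ, E) x).symm (range 𝓘(ℝ, E)) y =
      mfderiv 𝓘(ℝ, E) 𝓘(ℝ, E) (extChartAt 𝓘(ℝ, E) x).symm y := by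
    rw [modelWithCornersSelf_coe, range_id, mfderivWithin_univ]
  have h3 : oneFormInChart θ x y (vectorFieldInChart V x y) =
    (θ ((extChartAt 𝓘(ℝ, E) x).symm y))
      ((mfderiv 𝓘(ℝ, E) 𝓘(ℝ, E) (extChartAt 𝓘(ℝ, E) x).symm y)
      ((mfderivWithin 𝓘(ℝ, E) 𝓘(ℝ, E) (extChartAt 𝓘(ℝ, E) x).symm (range 𝓘(ℝ, E)) y).inverse
        (V ((extChartAt 𝓘(ℝ, E) x).symm y)))) := rfl
  rw [h3, ← h2, this]

lemma vectorFieldInChart_self (V : Π x : M, TangentSpace 𝓘(ℝ, E) x) (x : M) :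
    vectorFieldInChart V x (extChartAt 𝓘(ℝ, E) x x) = V x := by
  have := mfderivWithin_extChartAt_symm_inverse_apply (I := 𝓘(ℝ, E)) (x := x)
    (V ((extChartAt 𝓘(ℝ, E) x).symm (extChartAt 𝓘(ℝ, E) x x)))
  refine (show vectorFieldInChart V x (extChartAt 𝓘(ℝ, E) x x) = _ from this).trans ?_
  exact congrArg (β := E) (fun z ↦ (V z : E)) (extChartAt_to_inv x)

lemma oneFormInChart_self (θ : Π x : M, TangentSpace 𝓘(ℝ, E) x →L[ℝ] F) (x : M) :
    oneFormInChart θ x (extChartAt 𝓘(ℝ, E) x x) = (θ x : E →L[ℝ] F) := by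
  have := mfderivWithin_range_extChartAt_symm (I := 𝓘(ℝ, E)) (x := x)
  rw [modelWithCornersSelf_coe, range_id, mfderivWithin_univ] at this
  rw [oneFormInChart]
  refine (congrArg (fun L : E →L[ℝ] E ↦ (θ ((extChartAt 𝓘(ℝ, E) x).symm
    (extChartAt 𝓘(ℝ, E) x x)) : E →L[ℝ] F).comp L) this).trans ?_
  exact congrArg (β := E →L[ℝ] F) (fun z ↦ (θ z : E →L[ℝ] F)) (extChartAt_to_inv x)

/-- The manifold bracket is the bracket in the chart carried back by the chart's derivative, which
is the identity at the base point. -/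
lemma mlieBracket_eq_lieBracket_inChart [CompleteSpace E] {V W : Π x : M, TangentSpace 𝓘(ℝ, E) x}
    (x : M) :
    mlieBracket 𝓘(ℝ, E) V W x = lieBracket ℝ (vectorFieldInChart V x) (vectorFieldInChart W x)
      (extChartAt 𝓘(ℝ, E) x x) := by
  have hid : ∀ (L : E →L[ℝ] E) (w : E), L = .id ℝ E → L.inverse w = w := by
    rintro _ w rfl
    simp
  rw [← mlieBracketWithin_univ, mlieBracketWithin_apply, ← lieBracketWithin_univ]
  refine (hid _ _ mfderiv_extChartAt_self).trans ?_
  have hs : (extChartAt 𝓘(ℝ, E) x).symm ⁻¹' univ ∩ range 𝓘(ℝ, E) = univ := by simp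
  exact congrArg (fun s ↦ lieBracketWithin ℝ (vectorFieldInChart V x) (vectorFieldInChart W x) s
    (extChartAt 𝓘(ℝ, E) x x)) hs

/-- The derivative of `θ(V)` in coordinates. -/
lemma mvfderiv_oneForm_apply {θ : Π x : M, TangentSpace 𝓘(ℝ, E) x →L[ℝ] F}
    {V : Π x : M, TangentSpace 𝓘(ℝ, E) x} {x : M}
    (hθ : DifferentiableAt ℝ (oneFormInChart θ x) (extChartAt 𝓘(ℝ, E) x x))
    (hV : DifferentiableAt ℝ (vectorFieldInChart V x) (extChartAt 𝓘(ℝ, E) x x))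
    (w : TangentSpace 𝓘(ℝ, E) x) :
    mvfderiv 𝓘(ℝ, E) (fun y ↦ θ y (V y)) x w =
      fderiv ℝ (oneFormInChart θ x) (extChartAt 𝓘(ℝ, E) x x) (w : E) (V x : E) +
      (θ x : E →L[ℝ] F) (fderiv ℝ (vectorFieldInChart V x) (extChartAt 𝓘(ℝ, E) x x) (w : E)) := by
  set φ := extChartAt 𝓘(ℝ, E) x with hφ
  have hD := hθ.hasFDerivAt.clm_apply hV.hasFDerivAt
  have hev : (fun y ↦ θ y (V y)) =ᶠ[𝓝 x]
      (fun y ↦ oneFormInChart θ x y (vectorFieldInChart V x y)) ∘ φ := by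
    filter_upwards [extChartAt_source_mem_nhds (I := 𝓘(ℝ, E)) x] with z hz
    rw [Function.comp_apply, oneFormInChart_vectorFieldInChart θ V x (φ.map_source hz)]
    exact congrArg (fun z ↦ θ z (V z)) (φ.left_inv hz).symm
  have h1 : mfderiv 𝓘(ℝ, E) 𝓘(ℝ, F) (fun y ↦ θ y (V y)) x =
      mfderiv 𝓘(ℝ, E) 𝓘(ℝ, F)
        ((fun y ↦ oneFormInChart θ x y (vectorFieldInChart V x y)) ∘ φ) x := hev.mfderiv_eq
  have h2 := mfderiv_comp x (I := 𝓘(ℝ, E)) (I' := 𝓘(ℝ, E)) (I'' := 𝓘(ℝ, F))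
    (g := fun y ↦ oneFormInChart θ x y (vectorFieldInChart V x y)) (f := φ)
    hD.differentiableAt.mdifferentiableAt (mdifferentiableAt_extChartAt (by simp))
  rw [mfderiv_extChartAt_self, mfderiv_eq_fderiv, hD.fderiv] at h2
  have h3 := DFunLike.congr_fun (h1.trans h2) w
  refine (show mvfderiv 𝓘(ℝ, E) (fun y ↦ θ y (V y)) x w = _ from h3).trans ?_
  rw [vectorFieldInChart_self, oneFormInChart_self]
  exact add_comm _ _

/-- The invariant formula `dθ(V, W) = V(θ(W)) - W(θ(V)) - θ([V, W])`. -/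
lemma extDerivOneForm_apply_vectorField [CompleteSpace E]
    {θ : Π x : M, TangentSpace 𝓘(ℝ, E) x →L[ℝ] F} {V W : Π x : M, TangentSpace 𝓘(ℝ, E) x} {x : M}
    (hθ : DifferentiableAt ℝ (oneFormInChart θ x) (extChartAt 𝓘(ℝ, E) x x))
    (hV : MDifferentiableAt 𝓘(ℝ, E) 𝓘(ℝ, E).tangent
      (fun y ↦ (⟨y, V y⟩ : TangentBundle 𝓘(ℝ, E) M)) x)
    (hW : MDifferentiableAt 𝓘(ℝ, E) 𝓘(ℝ, E).tangent
      (fun y ↦ (⟨y, W y⟩ : TangentBundle 𝓘(ℝ, E) M)) x) :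
    extDerivOneForm θ x (V x) (W x) =
      mvfderiv 𝓘(ℝ, E) (fun y ↦ θ y (W y)) x (V x) -
        mvfderiv 𝓘(ℝ, E) (fun y ↦ θ y (V y)) x (W x) - θ x (mlieBracket 𝓘(ℝ, E) V W x) := by
  have hL : lieBracket ℝ (vectorFieldInChart V x) (vectorFieldInChart W x)
      (extChartAt 𝓘(ℝ, E) x x) =
      fderiv ℝ (vectorFieldInChart W x) (extChartAt 𝓘(ℝ, E) x x) (V x : E) -
        fderiv ℝ (vectorFieldInChart V x) (extChartAt 𝓘(ℝ, E) x x) (W x : E) := by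
    rw [lieBracket, vectorFieldInChart_self, vectorFieldInChart_self]
  rw [mvfderiv_oneForm_apply hθ (differentiableAt_vectorFieldInChart hV),
    mvfderiv_oneForm_apply hθ (differentiableAt_vectorFieldInChart hW),
    mlieBracket_eq_lieBracket_inChart, extDerivOneForm_eq, hL]
  -- The terms `θ(DW(V)) - θ(DV(W))` from the two product rules are exactly `θ([V, W])`.
  refine Eq.trans ?_ (congrArg _ ((θ x : E →L[ℝ] F).map_sub _ _).symm)
  abel

end ExteriorDerivativeFormula

/-! ### The clock component of the torsion of a compatible linear connection -/

section CompatibleConnection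

variable {m : ℕ} {M : Type*} [TopologicalSpace M] [ChartedSpace (ModelE m) M]
  [IsManifold (𝓡 (m + 1)) ∞ M]

/-- If `∇τ = 0` and `∇Z = 0`, then `τ(T(Z, v)) = dτ(Z, v)`. -/
lemma IsCompatibleConnection.τ_torsion {A : AristotelianStructure m M} {cov : LinearConnection m M}
    (hcov : IsCompatibleConnection A cov) (x : M) (v : TangentSpace (𝓡 (m + 1)) x) :
    A.τ x (cov.torsion x (A.Z x) v) = extDerivOneForm A.τ x (A.Z x) v := by
  -- Both sides depend on `v` alone, so any extension to a field differentiable at `x` will do.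
  set V := FiberBundle.extend (ModelE m) v with hVdef
  have hV : VectorFieldDiffAt V x := FiberBundle.mdifferentiableAt_extend _ _ v
  have hVx : V x = v := by simp [hVdef]
  have hZ : VectorFieldDiffAt A.Z x := (A.smooth_Z x).mdifferentiableAt (by simp)
  have hτ : OneFormDiffAt A.τ x := (A.smooth_τ x).mdifferentiableAt (by simp)
  have h1 := extDerivOneForm_apply_vectorField
    ((A.smooth_τ.contDiffAt_oneFormInChart x).differentiableAt (by simp)) hZ hV
  have h2 := cov.torsion_apply hZ hV
  have h3 : mvfderiv (𝓡 (m + 1)) (fun y ↦ A.τ y (V y)) x (A.Z x) = A.τ x (cov V x (A.Z x)) := by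
    have := DFunLike.congr_fun (hcov.cov_τ x (A.Z x)) (V x)
    -- Differentiability of `τ` rules out the default value of `covOneForm`, so its vanishing really
    -- says `Z(τ(V)) = τ(∇_Z V)`.
    rw [covOneForm, dif_pos hτ, TensorialAt.mkHom_apply _ hV] at this
    exact sub_eq_zero.1 this
  have h4 : mvfderiv (𝓡 (m + 1)) (fun y ↦ A.τ y (A.Z y)) x = 0 := by
    simp only [A.τ_Z]
    exact mvfderiv_const ..
  rw [hVx, hcov.cov_Z, sub_zero] at h2
  rw [hVx, h3, h4] at h1
  rw [h2, h1, map_sub]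
  simp

end CompatibleConnection

theorem mainTheorem11 (m : ℕ)
    {M : Type*} [TopologicalSpace M] [T2Space M] [SecondCountableTopology M]
    [ChartedSpace (ModelE m) M] [IsManifold (𝓡 (m + 1)) ∞ M]
    (A : AristotelianStructure m M) (hA : A.IsIntegrable)
    -- the one-form `α` with `dτ = τ ∧ α` and `ι_Z α = 0`
    (α : Π x : M, TangentSpace (𝓡 (m + 1)) x →L[ℝ] ℝ) (hα : SmoothOneForm α)
    (hτα : ∀ (x : M) (v w : TangentSpace (𝓡 (m + 1)) x),
      extDerivOneForm A.τ x v w = A.τ x v * α x w - A.τ x w * α x v)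
    (hZα : ∀ x : M, α x (A.Z x) = 0) :
    (∀ (EP : Type*) [NormedAddCommGroup EP] [NormedSpace ℝ EP] [FiniteDimensional ℝ EP]
      (P : Type*) [TopologicalSpace P] [ChartedSpace EP P] [IsManifold 𝓘(ℝ, EP) ∞ P]
      (S : GAStructure m M (EP := EP) P), S.Defines A →
      ∀ conn : (Π p : P, TangentSpace 𝓘(ℝ, EP) p →L[ℝ] (FrameModel m →L[ℝ] FrameModel m)),
      S.IsEhresmannConnection conn →
      ∀ Zbar : (Π p : P, TangentSpace 𝓘(ℝ, EP) p), S.IsHorizontalLift conn A.Z Zbar →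
      ∀ (p : P) (ξ : TangentSpace 𝓘(ℝ, EP) p),
        α (S.proj p) (S.dπ p ξ) = A.τ (S.proj p) (S.u p (S.torsionForm conn p (Zbar p) ξ))) ∧
    (∀ cov : LinearConnection m M, IsCompatibleConnection A cov →
      ∀ (x : M) (v : TangentSpace (𝓡 (m + 1)) x),
        α x v = A.τ x (cov.torsion x (A.Z x) v)) := by
  refine ⟨fun EP _ _ _ P _ _ _ S hS conn hconn Zbar hZbar p ξ ↦ ?_, fun cov hcov x v ↦ ?_⟩
  · rw [S.τ_torsionForm hS hconn.mem_lie, hτα, (hZbar p).2, A.τ_Z, hZα]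
    ring
  · rw [hcov.τ_torsion, hτα, A.τ_Z, hZα]
    ring
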